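/- Let $k$ be a field endowed with the trivial absolute value, let $X$ be a variety over $k$ (a separated integral scheme of finite type over $k$), and let $G$ be a finite group whose order is not divisible by the characteristic of $k$ (no condition in characteristic $0$), acting on $X$ by $k$-automorphisms. A point $x$ of the Berkovich analytification $X^{\mathrm{an}}$ is a scheme point $\pi(x)\in X$ together with a non-Archimedean absolute value $|\cdot|_x$ on $\kappa(\pi(x))$ that is trivial on $k$; it is called a valuation if $\pi(x)$ is the generic point of $X$. Write $\mathscr H(x)$ for the completion of $\kappa(\pi(x))$ with respect to $|\cdot|_x$, $\mathscr H(x)^\circ=\{|a|\le 1\}$, $\mathscr H(x)^{\circ\circ}=\{|a|<1\}$, and $\widetilde{\mathscr H(x)}=\mathscr H(x)^\circ/\mathscr H(x)^{\circ\circ}$ for the double residue field. The center $c_X(x)$ of $x$ in $X$, when it exists, is the image of the closed point under the extension $\operatorname{Spec}\mathscr H(x)^\circ\to X$ of the canonical morphism $\operatorname{Spec}\mathscr H(x)\to X$; there is then a canonical embedding $\kappa(c_X(x))\hookrightarrow\widetilde{\mathscr H(x)}$. Let $X^*$ be the set of valuations $x\in X^{\mathrm{an}}$ such that, for some blow-up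 $X'\to X$ along a nonzero coherent ideal sheaf, $x$, regarded as a valuation on $X'$, has a center in $X'$ and $\kappa(c_{X'}(x))=\widetilde{\mathscr H(x)}$. Let $x\in X^*$ be $G$-invariant (that is, $\sigma^{\mathrm{an}}(x)=x$ for all $\sigma\in G$) with center $p\in X$, and let $U\subseteq X$ be a $G$-stable affine open set containing $p$. Let $\phi:U\to U/G=\operatorname{Spec}\mathcal O_X(U)^G$ be the geometric quotient, given by the inclusion $\mathcal O_X(U)^G\subseteq\mathcal O_X(U)$, and let $y=\phi^{\mathrm{an}}(x)\in(U/G)^{\mathrm{an}}$, where $x$ is regarded as a point of $U^{\mathrm{an}}$. Then $$\widetilde{\mathscr H(x)}^{\,G}=\widetilde{\mathscr H(y)},$$ that is, the canonical embedding $\widetilde{\mathscr H(y)}\hookrightarrow\widetilde{\mathscr H(x)}$ induced by $\phi$ has image the field of $G$-invariants of $\widetilde{\mathscr H(x)}$. -/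

import Mathlib

open AlgebraicGeometry CategoryTheory

universe u

noncomputable section

namespace Berkovich

variable {k : Type u} [Field k]

/-! ### Points of the analytification over a trivially valued field -/

/-- The structure map `k → κ(ξ)` of the residue field of a `k`-scheme at a point `ξ`. -/
def scalar (X : Over (Spec (.of k))) (ξ : X.left) : k →+* X.left.residueField ξ :=
  (Spec.preimage (X.left.fromSpecResidueField ξ ≫ X.hom)).hom

/-- A point of the Berkovich analytification `X^an` of a scheme `X` locally of finite type over the
trivially valued field `k`: a scheme point `pt` (the image of the point under `X^an → X`) together
with a non-Archimedean absolute value on the residue field `κ(pt)` that extends the trivial absolute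
value of `k`. On an affine open `Spec A` this is the same thing as a multiplicative seminorm on `A`
extending the trivial absolute value of `k`, the scheme point being its kernel. -/
structure An (X : Over (Spec (.of k))) where
  pt : X.left
  abs : AbsoluteValue (X.left.residueField pt) ℝ
  nonarch : IsNonarchimedean abs
  trivial_on : ∀ c : k, c ≠ 0 → abs (scalar X pt c) = 1

/-- The point is a valuation: it lies over the generic point of `X`, that is, it is an absolute
value on the function field. -/
def An.IsValuation {X : Over (Spec (.of k))} (x : An X) : Prop :=
  IsGenericPoint x.pt Set.univ

theorem residueFieldMap_scalar {X Y : Over (Spec (.of k))} (f : X ⟶ Y) (ξ : X.left) (c : k) :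
    (f.left.residueFieldMap ξ).hom (scalar Y (f.left ξ) c) = scalar X ξ c := by
  have h : Spec.preimage (Y.left.fromSpecResidueField (f.left ξ) ≫ Y.hom) ≫
      f.left.residueFieldMap ξ = Spec.preimage (X.left.fromSpecResidueField ξ ≫ X.hom) := by
    apply Spec.map_injective
    rw [Spec.map_comp, Spec.map_preimage, Spec.map_preimage, ← Category.assoc,
      Scheme.Hom.SpecMap_residueFieldMap_fromSpecResidueField, Category.assoc, Over.w]
  exact congrArg (fun t => t.hom c) h

/-- The map `f^an : X^an → Y^an` induced by a morphism `f : X → Y` of `k`-schemes: the absolute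
value is pulled back along `κ(f ξ) → κ(ξ)`. -/
def An.map {X Y : Over (Spec (.of k))} (f : X ⟶ Y) (x : An X) : An Y where
  pt := f.left x.pt
  abs := x.abs.comp (f.left.residueFieldMap x.pt).hom.injective
  nonarch a b := by
    have := x.nonarch ((f.left.residueFieldMap x.pt).hom a)
      ((f.left.residueFieldMap x.pt).hom b)
    rw [← map_add] at this
    exact this
  trivial_on c hc := by
    have := x.trivial_on c hc
    rw [← residueFieldMap_scalar f] at this
    exact this

/-! ### The Berkovich residue field and the double residue field -/

/-- The Berkovich residue field `ℋ(x)`: the completion of `κ(pt)` with respect to `x`. -/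
abbrev An.H {X : Over (Spec (.of k))} (x : An X) : Type u := x.abs.Completion

/-- The canonical embedding `κ(pt) → ℋ(x)`. -/
def An.toH {X : Over (Spec (.of k))} (x : An X) : X.left.residueField x.pt →+* x.H :=
  (UniformSpace.Completion.coeRingHom).comp (WithAbs.equiv x.abs).symm.toRingHom

theorem An.H_nonarch {X : Over (Spec (.of k))} (x : An X) (a b : x.H) :
    ‖a + b‖ ≤ max ‖a‖ ‖b‖ := by
  refine UniformSpace.Completion.induction_on₂ a b ?_ ?_
  · exact isClosed_le (by fun_prop) (by fun_prop)
  · intro a b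
    rw [← UniformSpace.Completion.coe_add, UniformSpace.Completion.norm_coe,
      UniformSpace.Completion.norm_coe, UniformSpace.Completion.norm_coe]
    exact x.nonarch a.ofAbs b.ofAbs

/-- The valuation ring `ℋ(x)° = {a ∈ ℋ(x) : |a| ≤ 1}`. -/
def An.unitBall {X : Over (Spec (.of k))} (x : An X) : ValuationSubring x.H where
  carrier := {a | ‖a‖ ≤ 1}
  mul_mem' {a b} ha hb := by
    simp only [Set.mem_ofPred_eq, norm_mul] at *
    exact mul_le_one₀ ha (norm_nonneg _) hb
  one_mem' := by simp
  add_mem' {a b} ha hb := (x.H_nonarch a b).trans (max_le ha hb)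
  zero_mem' := by simp
  neg_mem' {a} ha := by simpa using ha
  mem_or_inv_mem' a := by
    simp only [Set.mem_ofPred_eq, norm_inv]
    rcases le_total ‖a‖ 1 with h | h
    · exact Or.inl h
    · exact Or.inr (inv_le_one_of_one_le₀ h)

theorem An.mem_unitBall {X : Over (Spec (.of k))} (x : An X) (a : x.H) :
    a ∈ x.unitBall ↔ ‖a‖ ≤ 1 := Iff.rfl

theorem An.isUnit_unitBall {X : Over (Spec (.of k))} (x : An X) (a : x.unitBall) :
    IsUnit a ↔ ‖(a : x.H)‖ = 1 := by
  constructor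
  · rintro ⟨u, rfl⟩
    have h1 : ‖((u : x.unitBall) : x.H)‖ ≤ 1 := (u : x.unitBall).2
    have h2 : ‖(((u⁻¹ : (x.unitBall)ˣ) : x.unitBall) : x.H)‖ ≤ 1 := (u⁻¹).1.2
    have h3 : ((u : x.unitBall) : x.H) * (((u⁻¹ : (x.unitBall)ˣ) : x.unitBall) : x.H) = 1 :=
      congrArg Subtype.val (Units.mul_inv u)
    have h4 := congrArg norm h3
    rw [norm_mul, norm_one] at h4
    nlinarith [norm_nonneg ((u : x.unitBall) : x.H)]
  · intro h
    have h0 : (a : x.H) ≠ 0 := by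
      intro h0
      simp [h0] at h
    refine IsUnit.of_mul_eq_one (⟨(a : x.H)⁻¹, ?_⟩ : x.unitBall) ?_
    · rw [An.mem_unitBall, norm_inv, h, inv_one]
    · exact Subtype.ext (mul_inv_cancel₀ h0)

/-- The double residue field `ℋ(x)° / ℋ(x)°°`, where the maximal ideal of the local ring `ℋ(x)°` is
`ℋ(x)°° = {a : |a| < 1}`. -/
abbrev An.DRes {X : Over (Spec (.of k))} (x : An X) : Type u :=
  IsLocalRing.ResidueField x.unitBall

/-- The ideal `ℋ(x)°°` consists of the elements of absolute value less than one. -/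
theorem An.mem_maximalIdeal {X : Over (Spec (.of k))} (x : An X) (a : x.unitBall) :
    a ∈ IsLocalRing.maximalIdeal x.unitBall ↔ ‖(a : x.H)‖ < 1 := by
  rw [IsLocalRing.mem_maximalIdeal, mem_nonunits_iff, x.isUnit_unitBall]
  exact ⟨fun h => lt_of_le_of_ne a.2 h, fun h => h.ne⟩

/-- The map `κ(f ξ) → κ(ξ)`, which is isometric for the absolute values of `f^an(x)` and `x`. -/
def An.resHom {X Y : Over (Spec (.of k))} (f : X ⟶ Y) (x : An X) :
    WithAbs (x.map f).abs →+* WithAbs x.abs :=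
  WithAbs.map (x.map f).abs x.abs (f.left.residueFieldMap x.pt).hom

theorem An.resHom_isometry {X Y : Over (Spec (.of k))} (f : X ⟶ Y) (x : An X) :
    Isometry (x.resHom f) :=
  AddMonoidHomClass.isometry_of_norm _ fun _ => rfl

/-- The isometric embedding `ℋ(f^an(x)) → ℋ(x)` induced by `f`. -/
def An.HMap {X Y : Over (Spec (.of k))} (f : X ⟶ Y) (x : An X) : (x.map f).H →+* x.H :=
  UniformSpace.Completion.mapRingHom (x.resHom f) (x.resHom_isometry f).continuous

theorem An.norm_HMap {X Y : Over (Spec (.of k))} (f : X ⟶ Y) (x : An X) (a : (x.map f).H) :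
    ‖x.HMap f a‖ = ‖a‖ :=
  (AddMonoidHomClass.isometry_iff_norm (x.HMap f)).1
    (x.resHom_isometry f).completion_map a

/-- The induced map `ℋ(f^an(x))° → ℋ(x)°`. -/
def An.unitBallMap {X Y : Over (Spec (.of k))} (f : X ⟶ Y) (x : An X) :
    (x.map f).unitBall →+* x.unitBall :=
  ((x.HMap f).comp (x.map f).unitBall.subtype).codRestrict x.unitBall fun a => by
    rw [An.mem_unitBall]
    exact (x.norm_HMap f a).le.trans a.2

instance An.isLocalHom_unitBallMap {X Y : Over (Spec (.of k))} (f : X ⟶ Y) (x : An X) :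
    IsLocalHom (x.unitBallMap f) where
  map_nonunit a ha := by
    rw [An.isUnit_unitBall] at ha ⊢
    rw [← ha]
    exact (x.norm_HMap f a).symm

/-- The embedding of double residue fields induced by `f`, from that of `f^an(x)` to that
of `x`. -/
def An.DResMap {X Y : Over (Spec (.of k))} (f : X ⟶ Y) (x : An X) :
    (x.map f).DRes →+* x.DRes :=
  IsLocalRing.ResidueField.map (x.unitBallMap f)

/-- Equal points have the same double residue field. -/
def An.DResCongr {X : Over (Spec (.of k))} {x x' : An X} (h : x = x') : x.DRes ≃+* x'.DRes := by
  subst h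
  exact RingEquiv.refl _

/-! ### Centers -/

/-- The canonical morphism `Spec ℋ(x) → X`. -/
def An.fromSpecH {X : Over (Spec (.of k))} (x : An X) : Spec (.of x.H) ⟶ X.left :=
  Spec.map (CommRingCat.ofHom x.toH) ≫ X.left.fromSpecResidueField x.pt

/-- `h : Spec ℋ(x)° → X` extends the canonical morphism `Spec ℋ(x) → X`. (Such an `h` is
automatically a morphism over `k`, because `ℋ(x)° → ℋ(x)` is injective.) -/
def An.IsCenterMap {X : Over (Spec (.of k))} (x : An X) (h : Spec (.of x.unitBall) ⟶ X.left) :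
    Prop :=
  Spec.map (CommRingCat.ofHom x.unitBall.subtype) ≫ h = x.fromSpecH

/-- `p` is the center of `x` in `X`: the morphism `Spec ℋ(x) → X` extends to `Spec ℋ(x)°`, and the
extension sends the closed point to `p`. -/
def An.IsCenter {X : Over (Spec (.of k))} (x : An X) (p : X.left) : Prop :=
  ∃ h : Spec (.of x.unitBall) ⟶ X.left,
    x.IsCenterMap h ∧ h (IsLocalRing.closedPoint x.unitBall) = p

/-- The restriction of `h : Spec ℋ(x)° → X` to the closed point, a morphism from the spectrum of the
double residue field. -/
def An.centerPoint {X : Over (Spec (.of k))} (x : An X) (h : Spec (.of x.unitBall) ⟶ X.left) :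
    Spec (.of x.DRes) ⟶ X.left :=
  Spec.map (CommRingCat.ofHom (IsLocalRing.residue x.unitBall)) ≫ h

/-- The homomorphism from the residue field of `X` at the image `c` of the closed point under
`h : Spec ℋ(x)° → X` to the double residue field of `x`. For a center map `h`, it is the canonical
embedding of the residue field at the center. -/
def An.centerResidueMap {X : Over (Spec (.of k))} (x : An X)
    (h : Spec (.of x.unitBall) ⟶ X.left) :
    X.left.residueField (Scheme.SpecToEquivOfField x.DRes X.left (x.centerPoint h)).1 →+*
      x.DRes :=
  (Scheme.SpecToEquivOfField x.DRes X.left (x.centerPoint h)).2.hom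

/-! ### Blow-ups and the class of valuations `X^*` -/

/-- An ideal sheaf is invertible: locally generated by one non-zero-divisor. -/
def IsInvertibleIdeal {X : Scheme.{u}} (I : X.IdealSheafData) : Prop :=
  ∀ p : X, ∃ U : X.affineOpens, p ∈ U.1 ∧
    ∃ a ∈ nonZeroDivisors Γ(X, U.1), I.ideal U = Ideal.span {a}

/-- `π : X' → X` is the blow-up of `X` along the ideal sheaf `I`, by its universal property: the
inverse image ideal sheaf of `I` on `X'` is invertible, and every morphism to `X` with this property
factors uniquely through `π`. -/
def IsBlowUp {X X' : Scheme.{u}} (I : X.IdealSheafData) (π : X' ⟶ X) : Prop :=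
  IsInvertibleIdeal (I.comap π) ∧
    ∀ (Z : Scheme.{u}) (f : Z ⟶ X), IsInvertibleIdeal (I.comap f) → ∃! g : Z ⟶ X', g ≫ π = f

/-- `x` belongs to `X^*`: it is a valuation, and there is a blow-up `π : X' → X` such that `x`,
regarded as a valuation `x'` on `X'`, has a center `c` on `X'` for which the canonical embedding of
the residue field `κ(c)` in the double residue field of `x` is onto. -/
def An.InStar {X : Over (Spec (.of k))} (x : An X) : Prop :=
  x.IsValuation ∧
    ∃ (X' : Over (Spec (.of k))) (π : X' ⟶ X) (I : X.left.IdealSheafData),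
      I ≠ ⊥ ∧ IsBlowUp I π.left ∧
      ∃ x' : An X', x'.IsValuation ∧ x'.map π = x ∧
        ∃ h : Spec (.of x'.unitBall) ⟶ X'.left,
          x'.IsCenterMap h ∧ Function.Surjective (x'.centerResidueMap h)

/-! ### Group actions -/

/-- The point `x` is invariant under the action `ρ` of `G` on `X`. -/
def An.IsInvariant {X : Over (Spec (.of k))} {G : Type*} [Group G] (ρ : G →* Aut X) (x : An X) :
    Prop :=
  ∀ g : G, x.map (ρ g).hom = x

/-- The action of `g` on the double residue field of an invariant point. -/
def An.actDRes {X : Over (Spec (.of k))} {G : Type*} [Group G] (ρ : G →* Aut X) (x : An X)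
    (hx : x.IsInvariant ρ) (g : G) : x.DRes →+* x.DRes :=
  (x.DResMap (ρ g).hom).comp (An.DResCongr (hx g).symm).toRingHom

/-- The ring of `G`-invariants of the double residue field of an invariant point. -/
def An.invariantsDRes {X : Over (Spec (.of k))} {G : Type*} [Group G] (ρ : G →* Aut X) (x : An X)
    (hx : x.IsInvariant ρ) : Subring x.DRes :=
  ⨅ g : G, (x.actDRes ρ hx g).eqLocus (RingHom.id _)

/-- The open set `U` is stable under the action of `G`. -/
def IsStable {X : Over (Spec (.of k))} {G : Type*} [Group G] (ρ : G →* Aut X) (U : X.left.Opens) :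
    Prop :=
  ∀ g : G, (ρ g).hom.left ⁻¹ᵁ U = U

/-- The open subscheme `U` of `X` as a `k`-scheme. -/
def openSub (X : Over (Spec (.of k))) (U : X.left.Opens) : Over (Spec (.of k)) :=
  Over.mk (U.ι ≫ X.hom)

/-- The inclusion of the open subscheme `U`. -/
def openIncl (X : Over (Spec (.of k))) (U : X.left.Opens) : openSub X U ⟶ X :=
  Over.homMk U.ι

/-- The ring `Γ(X, U)^G` of invariant functions on a stable open set `U`. -/
def invariantFunctions {X : Over (Spec (.of k))} {G : Type*} [Group G] (ρ : G →* Aut X)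
    (U : X.left.Opens) (hU : IsStable ρ U) : Subring Γ(X.left, U) :=
  ⨅ g : G, ((ρ g).hom.left.appLE U U (hU g).ge).hom.eqLocus (RingHom.id _)

/-- The structure morphism `k → Γ(X, U)`. -/
def scalarSection (X : Over (Spec (.of k))) (U : X.left.Opens) :
    CommRingCat.of k ⟶ Γ(X.left, U) :=
  (Scheme.ΓSpecIso (.of k)).inv ≫ X.hom.appTop ≫ X.left.presheaf.map (homOfLE le_top).op

theorem scalarSection_mem {X : Over (Spec (.of k))} {G : Type*} [Group G] (ρ : G →* Aut X)
    (U : X.left.Opens) (hU : IsStable ρ U) (c : k) :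
    (scalarSection X U).hom c ∈ invariantFunctions ρ U hU := by
  rw [invariantFunctions, Subring.mem_iInf]
  intro g
  have h : scalarSection X U ≫ (ρ g).hom.left.appLE U U (hU g).ge = scalarSection X U := by
    have w : (ρ g).hom.left ≫ X.hom = X.hom := Over.w (ρ g).hom
    have e : X.hom.appTop ≫ X.left.presheaf.map (homOfLE (le_top : U ≤ ⊤)).op ≫
        (ρ g).hom.left.appLE U U (hU g).ge =
        X.hom.appTop ≫ X.left.presheaf.map (homOfLE (le_top : U ≤ ⊤)).op := by
      rw [Scheme.Hom.map_appLE]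
      conv_rhs => rw [← w, Scheme.Hom.comp_appTop, Category.assoc]
      rfl
    simp only [scalarSection, Category.assoc, e]
  exact congrArg (fun t => t.hom c) h

/-- The quotient `U/G = Spec Γ(X, U)^G` of a stable affine open set `U`, as a `k`-scheme. -/
def quot {X : Over (Spec (.of k))} {G : Type*} [Group G] (ρ : G →* Aut X)
    (U : X.left.Opens) (hU : IsStable ρ U) : Over (Spec (.of k)) :=
  Over.mk (Spec.map (CommRingCat.ofHom ((scalarSection X U).hom.codRestrict
    (invariantFunctions ρ U hU) (scalarSection_mem ρ U hU))))

theorem toSpecΓ_scalarSection (X : Over (Spec (.of k))) (U : X.left.Opens) :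
    U.toSpecΓ ≫ Spec.map (scalarSection X U) = U.ι ≫ X.hom := by
  rw [scalarSection, Spec.map_comp, Spec.map_comp, Category.assoc]
  refine (Scheme.Opens.toSpecΓ_SpecMap_presheaf_map_top_assoc U _).trans ?_
  rw [← Scheme.toSpecΓ_naturality_assoc, toSpecΓ_SpecMap_ΓSpecIso_inv, Category.comp_id]

/-- The quotient morphism `φ : U → U/G`: the canonical morphism `U → Spec Γ(X, U)` (an isomorphism
for affine `U`) followed by the morphism given by the inclusion `Γ(X, U)^G ⊆ Γ(X, U)`. -/
def quotMap {X : Over (Spec (.of k))} {G : Type*} [Group G] (ρ : G →* Aut X)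
    (U : X.left.Opens) (hU : IsStable ρ U) : openSub X U ⟶ quot ρ U hU :=
  Over.homMk (U.toSpecΓ ≫ Spec.map (CommRingCat.ofHom (invariantFunctions ρ U hU).subtype)) (by
    have h : CommRingCat.ofHom ((scalarSection X U).hom.codRestrict
        (invariantFunctions ρ U hU) (scalarSection_mem ρ U hU)) ≫
        CommRingCat.ofHom (invariantFunctions ρ U hU).subtype = scalarSection X U := rfl
    simp only [quot, openSub, Over.mk_hom]
    rw [Category.assoc, ← Spec.map_comp, h, toSpecΓ_scalarSection])

/-! ### Restriction of points to open subsets -/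

/-- The inverse of the isomorphism from the residue field of `X` at a point `q` of the open
subscheme `U` to the residue field of `U` at `q`. -/
def resInv (X : Over (Spec (.of k))) (U : X.left.Opens) (q : (openSub X U).left) :
    (openSub X U).left.residueField q →+* X.left.residueField ((openIncl X U).left q) :=
  haveI : IsOpenImmersion (openIncl X U).left := inferInstanceAs (IsOpenImmersion U.ι)
  (inv ((openIncl X U).left.residueFieldMap q)).hom

theorem resInv_apply (X : Over (Spec (.of k))) (U : X.left.Opens) (q : (openSub X U).left)
    (a : X.left.residueField ((openIncl X U).left q)) :
    resInv X U q (((openIncl X U).left.residueFieldMap q).hom a) = a := by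
  have : IsOpenImmersion (openIncl X U).left := inferInstanceAs (IsOpenImmersion U.ι)
  exact congrArg (fun t => t.hom a) (IsIso.hom_inv_id ((openIncl X U).left.residueFieldMap q))

/-- A point of `X` in the open set `U`, as a point of the open subscheme `U`. -/
def openPt (X : Over (Spec (.of k))) (U : X.left.Opens) (ξ : X.left) (h : ξ ∈ U) :
    (openSub X U).left :=
  (⟨ξ, h⟩ : U)

/-- A point of `X^an` lying over the open set `U`, regarded as a point of `U^an`, by means of the
isomorphism between the residue fields of `X` and `U`. -/
def An.restrict {X : Over (Spec (.of k))} (x : An X) (U : X.left.Opens) (h : x.pt ∈ U) :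
    An (openSub X U) where
  pt := openPt X U x.pt h
  abs := x.abs.comp (resInv X U (openPt X U x.pt h)).injective
  nonarch a b := by
    have := x.nonarch (resInv X U (openPt X U x.pt h) a) (resInv X U (openPt X U x.pt h) b)
    exact (congrArg x.abs (map_add (resInv X U (openPt X U x.pt h)) a b)).trans_le this
  trivial_on c hc := by
    have h1 := x.trivial_on c hc
    have h2 := residueFieldMap_scalar (openIncl X U) (openPt X U x.pt h) c
    have h3 := resInv_apply X U (openPt X U x.pt h) (scalar X x.pt c)
    refine Eq.trans (congrArg x.abs ?_) h1
    exact (congrArg (resInv X U (openPt X U x.pt h)) h2.symm).trans h3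

/-- Restriction to `U` is inverse to the inclusion of `U^an` in `X^an`. -/
theorem An.map_restrict {X : Over (Spec (.of k))} (x : An X) (U : X.left.Opens) (h : x.pt ∈ U) :
    (x.restrict U h).map (openIncl X U) = x := by
  obtain ⟨ξ, v, h1, h2⟩ := x
  have key : ∀ w : AbsoluteValue (X.left.residueField ξ) ℝ, w = v →
      ∀ h1' h2', (An.mk ξ w h1' h2' : An X) = An.mk ξ v h1 h2 := by
    rintro w rfl _ _
    rfl
  exact key ((An.mk ξ v h1 h2 : An X).restrict U h |>.map (openIncl X U)).abs
    (AbsoluteValue.ext fun a => congrArg v (resInv_apply X U (openPt X U ξ h) a)) _ _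

/-- The identification of the double residue field of `x` with that of `x` regarded as a point of
`U^an`. -/
def An.DResRestrict {X : Over (Spec (.of k))} (x : An X) (U : X.left.Opens) (h : x.pt ∈ U) :
    x.DRes →+* (x.restrict U h).DRes :=
  ((x.restrict U h).DResMap (openIncl X U)).comp (An.DResCongr (x.map_restrict U h).symm).toRingHom

theorem An.IsValuation.mem {X : Over (Spec (.of k))} {x : An X} (hx : x.IsValuation)
    {U : X.left.Opens} {p : X.left} (hp : p ∈ U) : x.pt ∈ U :=
  hx.mem_open_set_iff U.isOpen |>.2 ⟨p, trivial, hp⟩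

end Berkovich

end

/-!
The double residue field of `x` is the residue field of the absolute value on `κ(pt)` itself, since
completing does not change residue fields (`An.exists_reducesTo`). In these terms the equality is an
averaging argument, which needs only that the order of `G` is a unit for the absolute value.

Let `d` be a `G`-invariant of the double residue field and let `c` in `κ(pt)` reduce to `d`. All
conjugates of `c` reduce to `d` too, so the mean of the conjugates is a lift of `d`. The trace of `c`
is a quotient of two `G`-invariant functions on `U`, as one sees by writing `c` with a `G`-invariant
denominator (`sum_actRes_mem_invariantFractions`). Thus the invariants are exactly the reductions
of quotients of invariant functions (`mem_invariantsDRes_iff`). On the other hand these quotients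
form the residue field of `U/G = Spec Γ(X, U)^G` at the image of `pt`
(`mem_range_residueFieldMap_quotMap_iff`), so their reductions are the image of the double residue
field of the image of `x` (`An.mem_range_DResMap_iff`).
-/

noncomputable section

namespace Berkovich

variable {k : Type u} [Field k]

/-! ### Reduction of elements of the residue field -/

theorem An.norm_toH {X : Over (Spec (.of k))} (x : An X) (a : X.left.residueField x.pt) :
    ‖x.toH a‖ = x.abs a :=
  UniformSpace.Completion.norm_coe _

theorem An.toH_mem_unitBall {X : Over (Spec (.of k))} (x : An X)
    (a : X.left.residueField x.pt) : x.toH a ∈ x.unitBall ↔ x.abs a ≤ 1 := by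
  rw [An.mem_unitBall, An.norm_toH]

/-- The element `a` of `κ(pt)` has absolute value at most one, and its class in the double residue
field of `x` is `d`. As a relation, it avoids carrying bounds on absolute values in the arguments of
the reduction map. -/
def An.ReducesTo {X : Over (Spec (.of k))} (x : An X) (a : X.left.residueField x.pt)
    (d : x.DRes) : Prop :=
  ∃ h : x.toH a ∈ x.unitBall, IsLocalRing.residue x.unitBall ⟨x.toH a, h⟩ = d

namespace An.ReducesTo

variable {X : Over (Spec (.of k))} {x : An X} {a b : X.left.residueField x.pt} {d e : x.DRes}

theorem unique (h : x.ReducesTo a d) (h' : x.ReducesTo a e) : d = e := by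
  obtain ⟨_, rfl⟩ := h
  obtain ⟨_, rfl⟩ := h'
  rfl

theorem abs_le (h : x.ReducesTo a d) : x.abs a ≤ 1 :=
  (x.toH_mem_unitBall a).1 h.1

theorem mul (h : x.ReducesTo a d) (h' : x.ReducesTo b e) : x.ReducesTo (a * b) (d * e) := by
  obtain ⟨ha, rfl⟩ := h
  obtain ⟨hb, rfl⟩ := h'
  have hab : x.toH (a * b) ∈ x.unitBall := (map_mul x.toH a b).symm ▸ mul_mem ha hb
  refine ⟨hab, ?_⟩
  rw [← map_mul (IsLocalRing.residue x.unitBall)]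
  exact congrArg _ (Subtype.ext (map_mul x.toH a b))

theorem sum {ι : Type*} (s : Finset ι) {a : ι → X.left.residueField x.pt} {d : ι → x.DRes}
    (h : ∀ i, x.ReducesTo (a i) (d i)) : x.ReducesTo (∑ i ∈ s, a i) (∑ i ∈ s, d i) := by
  choose ha hd using h
  have hs : x.toH (∑ i ∈ s, a i) ∈ x.unitBall :=
    (map_sum x.toH a s).symm ▸ sum_mem fun i _ => ha i
  refine ⟨hs, ?_⟩
  rw [← Finset.sum_congr rfl fun i _ => hd i, ← map_sum (IsLocalRing.residue x.unitBall)]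
  refine congrArg _ (Subtype.ext ?_)
  exact (map_sum x.toH a s).trans
    (map_sum x.unitBall.subtype (fun i => (⟨x.toH (a i), ha i⟩ : x.unitBall)) s).symm

theorem natCast (n : ℕ) : x.ReducesTo (n : X.left.residueField x.pt) (n : x.DRes) := by
  refine ⟨by rw [map_natCast]; exact natCast_mem _ n, ?_⟩
  rw [← map_natCast (IsLocalRing.residue x.unitBall)]
  exact congrArg _ (Subtype.ext (map_natCast x.toH n))

end An.ReducesTo

theorem An.exists_reducesTo_of_abs_le {X : Over (Spec (.of k))} (x : An X)
    {a : X.left.residueField x.pt} (h : x.abs a ≤ 1) : ∃ d, x.ReducesTo a d :=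
  ⟨_, (x.toH_mem_unitBall a).2 h, rfl⟩

/-- Completion does not enlarge the residue field: by density of `κ(pt)` in `ℋ(x)`, each element of
the double residue field is the reduction of an element of `κ(pt)`. -/
theorem An.exists_reducesTo {X : Over (Spec (.of k))} (x : An X) (d : x.DRes) :
    ∃ a, x.ReducesTo a d := by
  obtain ⟨⟨u, hu⟩, rfl⟩ := IsLocalRing.residue_surjective d
  have hdense : DenseRange x.toH := by
    have h := UniformSpace.Completion.denseRange_coe (α := WithAbs x.abs)
    exact h.comp (WithAbs.equiv x.abs).symm.surjective.denseRange
      (UniformSpace.Completion.continuous_coe _)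
  obtain ⟨a, ha⟩ := Metric.denseRange_iff.1 hdense u 1 one_pos
  rw [dist_eq_norm'] at ha
  have ha1 : x.toH a ∈ x.unitBall := by
    have := x.H_nonarch (x.toH a - u) u
    rw [sub_add_cancel] at this
    exact this.trans (max_le ha.le hu)
  refine ⟨a, ha1, ?_⟩
  rw [← sub_eq_zero, ← map_sub, IsLocalRing.residue_eq_zero_iff, An.mem_maximalIdeal]
  exact ha

theorem An.ReducesTo.map {X Y : Over (Spec (.of k))} (f : X ⟶ Y) {x : An X}
    {a : Y.left.residueField (x.map f).pt} {d : (x.map f).DRes} (h : (x.map f).ReducesTo a d) :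
    x.ReducesTo ((f.left.residueFieldMap x.pt).hom a) (x.DResMap f d) := by
  obtain ⟨ha, rfl⟩ := h
  have key : x.toH ((f.left.residueFieldMap x.pt).hom a) = x.HMap f ((x.map f).toH a) :=
    (UniformSpace.Completion.map_coe (x.resHom_isometry f).uniformContinuous _).symm
  refine ⟨?_, ?_⟩
  · rw [key, An.mem_unitBall, An.norm_HMap]
    exact ha
  · refine Eq.trans ?_ (IsLocalRing.ResidueField.map_residue (x.unitBallMap f) _).symm
    exact congrArg _ (Subtype.ext key)

/-- Equal points of `X^an` have the same residue field at the underlying scheme point. -/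
def An.resCongr {X : Over (Spec (.of k))} {x x' : An X} (h : x = x') :
    X.left.residueField x.pt ≃+* X.left.residueField x'.pt := by
  subst h
  exact RingEquiv.refl _

theorem An.ReducesTo.congr {X : Over (Spec (.of k))} {x x' : An X} (h : x = x')
    {a : X.left.residueField x.pt} {d : x.DRes} (hd : x.ReducesTo a d) :
    x'.ReducesTo (An.resCongr h a) (An.DResCongr h d) := by
  subst h
  exact hd

theorem An.abs_resCongr {X : Over (Spec (.of k))} {x x' : An X} (h : x = x')
    (a : X.left.residueField x.pt) : x'.abs (An.resCongr h a) = x.abs a := by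
  subst h
  rfl

theorem An.resCongr_evaluation {X : Over (Spec (.of k))} {x x' : An X} (h : x = x')
    (U : X.left.Opens) (hx : x.pt ∈ U) (hx' : x'.pt ∈ U) (s : Γ(X.left, U)) :
    An.resCongr h ((X.left.evaluation U x.pt hx).hom s) =
      (X.left.evaluation U x'.pt hx').hom s := by
  subst h
  rfl

/-- The residue field at a point of an affine open `U` consists of quotients of values of functions
on `U`. -/
theorem exists_evaluation_div {X : Scheme.{u}} {U : X.Opens} (hU : IsAffineOpen U) {ξ : X}
    (hξ : ξ ∈ U) (c : X.residueField ξ) :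
    ∃ a b : Γ(X, U), (X.evaluation U ξ hξ).hom b ≠ 0 ∧
      c * (X.evaluation U ξ hξ).hom b = (X.evaluation U ξ hξ).hom a := by
  obtain ⟨c, rfl⟩ := X.residue_surjective ξ c
  have := hU.isLocalization_stalk ⟨ξ, hξ⟩
  let : Algebra Γ(X, U) (X.presheaf.stalk ξ) := (X.presheaf.germ U ξ hξ).hom.toAlgebra
  obtain ⟨⟨a, b⟩, hab⟩ := IsLocalization.surj
    (hU.primeIdealOf ⟨ξ, hξ⟩).asIdeal.primeCompl (S := X.presheaf.stalk ξ) c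
  have hb : IsUnit ((X.presheaf.germ U ξ hξ).hom (b : Γ(X, U))) :=
    IsLocalization.map_units (X.presheaf.stalk ξ) b
  refine ⟨a, b, ?_, ?_⟩
  · exact (hb.map (X.residue ξ).hom).ne_zero
  · have := congrArg (X.residue ξ).hom hab
    rw [map_mul] at this
    exact this

/-! ### The action on functions and on residue fields -/

section Action

variable {X : Over (Spec (.of k))} {G : Type*} [Group G] (ρ : G →* Aut X)

/-- The action of `g` on the residue field `κ(pt)` of an invariant point, by pulling back along
`ρ g`. It induces the action `An.actDRes` on the double residue field. -/
def actRes (x : An X) (hx : x.IsInvariant ρ) (g : G) :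
    X.left.residueField x.pt →+* X.left.residueField x.pt :=
  ((ρ g).hom.left.residueFieldMap x.pt).hom.comp (An.resCongr (hx g).symm).toRingHom

theorem An.ReducesTo.act {x : An X} (hx : x.IsInvariant ρ) (g : G)
    {a : X.left.residueField x.pt} {d : x.DRes} (h : x.ReducesTo a d) :
    x.ReducesTo (actRes ρ x hx g a) (x.actDRes ρ hx g d) :=
  (h.congr (hx g).symm).map (ρ g).hom

/-- The pullback of functions on a stable open set `U` along `ρ g`. -/
def actSections (U : X.left.Opens) (hU : IsStable ρ U) (g : G) :
    Γ(X.left, U) →+* Γ(X.left, U) :=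
  ((ρ g).hom.left.appLE U U (hU g).ge).hom

theorem mem_invariantFunctions {U : X.left.Opens} {hU : IsStable ρ U} {s : Γ(X.left, U)} :
    s ∈ invariantFunctions ρ U hU ↔ ∀ g, actSections ρ U hU g s = s := by
  rw [invariantFunctions, Subring.mem_iInf]
  rfl

/-- Pulling back reverses the order of composition: this is a right action of `G`. -/
theorem actSections_mul (U : X.left.Opens) (hU : IsStable ρ U) (g h : G) (s : Γ(X.left, U)) :
    actSections ρ U hU h (actSections ρ U hU g s) = actSections ρ U hU (g * h) s := by
  have e : (ρ (g * h)).hom.left = (ρ h).hom.left ≫ (ρ g).hom.left := by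
    rw [map_mul]
    rfl
  have : (ρ g).hom.left.appLE U U (hU g).ge ≫ (ρ h).hom.left.appLE U U (hU h).ge =
      (ρ (g * h)).hom.left.appLE U U (hU (g * h)).ge := by
    rw [Scheme.Hom.appLE_comp_appLE]
    simp only [e]
  exact congrArg (fun t => t.hom s) this

theorem actSections_one (U : X.left.Opens) (hU : IsStable ρ U) (s : Γ(X.left, U)) :
    actSections ρ U hU 1 s = s := by
  have e : (ρ 1).hom.left = 𝟙 X.left := by
    rw [map_one]
    rfl
  have : (ρ 1).hom.left.appLE U U (hU 1).ge = 𝟙 _ := by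
    simp only [e]
    rw [Scheme.Hom.appLE, Scheme.Hom.id_app]
    exact (Category.id_comp _).trans (X.left.presheaf.map_id _)
  exact congrArg (fun t => t.hom s) this

theorem actRes_evaluation (x : An X) (hx : x.IsInvariant ρ) {U : X.left.Opens}
    (hU : IsStable ρ U) (hxU : x.pt ∈ U) (g : G) (s : Γ(X.left, U)) :
    actRes ρ x hx g ((X.left.evaluation U x.pt hxU).hom s) =
      (X.left.evaluation U x.pt hxU).hom (actSections ρ U hU g s) := by
  have hg : (x.map (ρ g).hom).pt ∈ U := by rwa [hx g]
  have h1 := An.resCongr_evaluation (hx g).symm U hxU hg s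
  have h2 := Scheme.evaluation_naturality_apply (ρ g).hom.left x.pt hg s
  refine (congrArg ((ρ g).hom.left.residueFieldMap x.pt).hom h1).trans (h2.trans ?_)
  have h3 : (ρ g).hom.left.app U ≫ X.left.evaluation ((ρ g).hom.left ⁻¹ᵁ U) x.pt hg =
      (ρ g).hom.left.appLE U U (hU g).ge ≫ X.left.evaluation U x.pt hxU := by
    rw [Scheme.Hom.appLE, Category.assoc]
    unfold Scheme.evaluation
    rw [X.left.presheaf.germ_res_assoc]
  exact congrArg (fun t => t.hom s) h3

/-- The set of quotients of values at `pt` of invariant functions on `U`. Denominators that vanish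
at `pt` are harmless, as they contribute only the quotient `0`, which is the value of `0 / 1`. -/
def An.invariantFractions (x : An X) {U : X.left.Opens} (hU : IsStable ρ U) (h : x.pt ∈ U) :
    Set (X.left.residueField x.pt) :=
  {c | ∃ a ∈ invariantFunctions ρ U hU, ∃ b ∈ invariantFunctions ρ U hU,
    (X.left.evaluation U x.pt h).hom a / (X.left.evaluation U x.pt h).hom b = c}

/-- The trace of an element `c` of `κ(pt)` is a quotient of invariant functions: if `c = a / b`,
then `c = r / N` for the norm `N = ∏ g^* b`, which is invariant, and the trace is `(∑ g^* r) / N`. -/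
theorem sum_actRes_mem_invariantFractions [Fintype G] (x : An X) (hx : x.IsInvariant ρ)
    {U : X.left.Opens} (hUaff : IsAffineOpen U) (hU : IsStable ρ U) (hxU : x.pt ∈ U)
    (c : X.left.residueField x.pt) :
    ∑ g, actRes ρ x hx g c ∈ x.invariantFractions ρ hU hxU := by
  classical
  obtain ⟨a, b, hb, hab⟩ := exists_evaluation_div hUaff hxU c
  set ψ := (X.left.evaluation U x.pt hxU).hom
  have act := actRes_evaluation ρ x hx hU hxU
  have hne (g : G) : ψ (actSections ρ U hU g b) ≠ 0 := by
    rw [← act]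
    exact (map_ne_zero _).2 hb
  set N : Γ(X.left, U) := ∏ g, actSections ρ U hU g b with hN
  have hNinv : ∀ g, actSections ρ U hU g N = N := fun h => by
    simp only [hN, map_prod, actSections_mul]
    exact Fintype.prod_equiv (Equiv.mulRight h) _ _ fun _ => rfl
  set r : Γ(X.left, U) := a * ∏ g ∈ Finset.univ.erase 1, actSections ρ U hU g b with hr
  have hcr : c * ψ N = ψ r := by
    rw [hN, ← Finset.mul_prod_erase _ _ (Finset.mem_univ (1 : G)), actSections_one, map_mul,
      ← mul_assoc, hab, hr, map_mul]
  refine ⟨∑ g, actSections ρ U hU g r, (mem_invariantFunctions ρ).2 fun h => ?_, N,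
    (mem_invariantFunctions ρ).2 hNinv, ?_⟩
  · simp only [map_sum, actSections_mul]
    exact Fintype.sum_equiv (Equiv.mulRight h) _ _ fun _ => rfl
  · have hN0 : ψ N ≠ 0 := by
      rw [hN, map_prod]
      exact Finset.prod_ne_zero_iff.2 fun g _ => hne g
    rw [div_eq_iff hN0, map_sum, Finset.sum_mul]
    refine Finset.sum_congr rfl fun g _ => ?_
    rw [← act, ← hcr, map_mul, act, hNinv]

end Action

/-! ### The quotient -/

section Quotient

variable {X : Over (Spec (.of k))}

/-- The isomorphism from the residue field of `X` to that of the open subscheme `U` at the point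
under `x`. It induces the identification `An.DResRestrict` of double residue fields. -/
def An.restrictRes (x : An X) (U : X.left.Opens) (h : x.pt ∈ U) :
    X.left.residueField x.pt →+* (openSub X U).left.residueField (x.restrict U h).pt :=
  ((openIncl X U).left.residueFieldMap (x.restrict U h).pt).hom.comp
    (An.resCongr (x.map_restrict U h).symm).toRingHom

theorem An.ReducesTo.restrict {x : An X} (U : X.left.Opens) (h : x.pt ∈ U)
    {a : X.left.residueField x.pt} {d : x.DRes} (hd : x.ReducesTo a d) :
    (x.restrict U h).ReducesTo (x.restrictRes U h a) (x.DResRestrict U h d) :=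
  (hd.congr (x.map_restrict U h).symm).map (openIncl X U)

theorem An.abs_restrictRes (x : An X) (U : X.left.Opens) (h : x.pt ∈ U)
    (a : X.left.residueField x.pt) :
    (x.restrict U h).abs (x.restrictRes U h a) = x.abs a :=
  An.abs_resCongr (x.map_restrict U h).symm a

theorem An.restrictRes_evaluation (x : An X) (U : X.left.Opens) (h : x.pt ∈ U)
    (s : Γ(X.left, U)) :
    x.restrictRes U h ((X.left.evaluation U x.pt h).hom s) =
      ((openSub X U).left.evaluation ⊤ (x.restrict U h).pt trivial).hom (U.topIso.inv.hom s) := by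
  have h1 := An.resCongr_evaluation (x.map_restrict U h).symm U h h s
  have h2 := Scheme.evaluation_naturality_apply (openIncl X U).left (x.restrict U h).pt
    (V := U) h s
  refine (congrArg ((openIncl X U).left.residueFieldMap _).hom h1).trans (h2.trans ?_)
  have h3 : U.ι.app U ≫ U.toScheme.evaluation (U.ι ⁻¹ᵁ U) (x.restrict U h).pt h =
      U.topIso.inv ≫ U.toScheme.evaluation ⊤ (x.restrict U h).pt trivial := by
    have : U.ι.app U ≫ U.toScheme.presheaf.map (eqToHom (by simp)).op = U.topIso.inv := by
      rw [Scheme.Opens.ι_app_self, Scheme.Opens.topIso_inv]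
      erw [← X.left.presheaf.map_comp]
      rfl
    rw [← this, Category.assoc]
    unfold Scheme.evaluation
    erw [U.toScheme.presheaf.germ_res_assoc]
  exact congrArg (fun t => t.hom s) h3

variable {G : Type*} [Group G] (ρ : G →* Aut X)

theorem quotMap_appTop (U : X.left.Opens) (hU : IsStable ρ U) :
    (Scheme.ΓSpecIso (.of (invariantFunctions ρ U hU))).inv ≫ (quotMap ρ U hU).left.appTop =
      CommRingCat.ofHom (invariantFunctions ρ U hU).subtype ≫ U.topIso.inv := by
  have key : (Scheme.ΓSpecIso (.of (invariantFunctions ρ U hU))).inv ≫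
      (U.toSpecΓ ≫ Spec.map (CommRingCat.ofHom (invariantFunctions ρ U hU).subtype)).appTop =
      CommRingCat.ofHom (invariantFunctions ρ U hU).subtype ≫ U.topIso.inv := by
    rw [Scheme.Hom.comp_appTop, ← Scheme.ΓSpecIso_inv_naturality_assoc,
      Scheme.Opens.toSpecΓ_appTop, Iso.inv_hom_id_assoc]
  exact key

/-- The identification of the invariant functions on `U` with the global functions on
`U/G = Spec Γ(X, U)^G`. -/
def quotSection (U : X.left.Opens) (hU : IsStable ρ U) :
    invariantFunctions ρ U hU ≃+* Γ((quot ρ U hU).left, ⊤) :=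
  (Scheme.ΓSpecIso (.of (invariantFunctions ρ U hU))).symm.commRingCatIsoToRingEquiv

theorem residueFieldMap_quotMap_evaluation (x : An X) {U : X.left.Opens}
    (hU : IsStable ρ U) (h : x.pt ∈ U) (s : invariantFunctions ρ U hU) :
    ((quotMap ρ U hU).left.residueFieldMap (x.restrict U h).pt).hom
      (((quot ρ U hU).left.evaluation ⊤ ((x.restrict U h).map (quotMap ρ U hU)).pt trivial).hom
        (quotSection ρ U hU s)) =
      x.restrictRes U h ((X.left.evaluation U x.pt h).hom s) := by
  rw [An.restrictRes_evaluation]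
  refine (Scheme.evaluation_naturality_apply (quotMap ρ U hU).left (x.restrict U h).pt
    (V := ⊤) trivial _).trans ?_
  have := congrArg (fun t => t.hom s) (quotMap_appTop ρ U hU)
  exact congrArg ((openSub X U).left.evaluation ⊤ (x.restrict U h).pt trivial).hom this

/-- The image of `f` on double residue fields consists of the reductions of elements of the image of
`f` on residue fields, because `κ(f ξ) → κ(ξ)` is isometric. -/
theorem An.mem_range_DResMap_iff {X Y : Over (Spec (.of k))} (f : X ⟶ Y) (x : An X) (d : x.DRes) :
    d ∈ (x.DResMap f).range ↔
      ∃ a ∈ (f.left.residueFieldMap x.pt).hom.range, x.ReducesTo a d := by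
  constructor
  · rintro ⟨e, rfl⟩
    obtain ⟨t, ht⟩ := (x.map f).exists_reducesTo e
    exact ⟨_, ⟨t, rfl⟩, ht.map f⟩
  · rintro ⟨_, ⟨t, rfl⟩, hd⟩
    obtain ⟨e, he⟩ := (x.map f).exists_reducesTo_of_abs_le (a := t) hd.abs_le
    exact ⟨e, (he.map f).unique hd⟩

/-- The residue field of `U/G` at the image of `pt` is the field of quotients of invariant
functions. -/
theorem mem_range_residueFieldMap_quotMap_iff (x : An X) {U : X.left.Opens}
    (hU : IsStable ρ U) (h : x.pt ∈ U)
    (c : (openSub X U).left.residueField (x.restrict U h).pt) :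
    c ∈ ((quotMap ρ U hU).left.residueFieldMap (x.restrict U h).pt).hom.range ↔
      ∃ c' ∈ x.invariantFractions ρ hU h, x.restrictRes U h c' = c := by
  have hφ := residueFieldMap_quotMap_evaluation ρ x hU h
  constructor
  · rintro ⟨t, rfl⟩
    have : IsAffine (quot ρ U hU).left :=
      inferInstanceAs (IsAffine (Spec (.of (invariantFunctions ρ U hU))))
    obtain ⟨a, b, hb, hab⟩ := exists_evaluation_div
      (isAffineOpen_top (quot ρ U hU).left) (ξ := ((x.restrict U h).map (quotMap ρ U hU)).pt)
      trivial t
    obtain ⟨a, rfl⟩ := (quotSection ρ U hU).surjective a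
    obtain ⟨b, rfl⟩ := (quotSection ρ U hU).surjective b
    refine ⟨_, ⟨a, a.2, b, b.2, rfl⟩, ?_⟩
    rw [map_div₀, ← hφ, ← hφ]
    exact (map_div₀ _ _ _).symm.trans (congrArg _ (eq_div_of_mul_eq hb hab).symm)
  · rintro ⟨_, ⟨a, ha, b, hb, rfl⟩, rfl⟩
    rw [map_div₀]
    exact ⟨_, (map_div₀ _ _ _).trans (congrArg₂ (· / ·) (hφ ⟨a, ha⟩) (hφ ⟨b, hb⟩))⟩

/-- An invariant of the double residue field lifts to a quotient of invariant functions: average any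
lift over `G`. The mean makes sense and has the same reduction, because `Nat.card G` is nonzero in
`k`, hence of absolute value one. -/
theorem mem_invariantsDRes_iff [Finite G] (hG : (Nat.card G : k) ≠ 0) (x : An X)
    (hx : x.IsInvariant ρ) {U : X.left.Opens} (hUaff : IsAffineOpen U) (hU : IsStable ρ U)
    (h : x.pt ∈ U) (d : x.DRes) :
    d ∈ x.invariantsDRes ρ hx ↔ ∃ c ∈ x.invariantFractions ρ hU h, x.ReducesTo c d := by
  have mem_inv : d ∈ x.invariantsDRes ρ hx ↔ ∀ g, x.actDRes ρ hx g d = d := by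
    rw [An.invariantsDRes, Subring.mem_iInf]
    rfl
  rw [mem_inv]
  constructor
  · intro hd
    have := Fintype.ofFinite G
    obtain ⟨c, hc⟩ := x.exists_reducesTo d
    have hsum : x.ReducesTo (∑ g, actRes ρ x hx g c) (Nat.card G * d) := by
      have := An.ReducesTo.sum Finset.univ fun g => hc.act ρ hx g
      simpa [hd] using this
    have hn : x.abs (Nat.card G : X.left.residueField x.pt) = 1 := by
      rw [← map_natCast (scalar X x.pt)]
      exact x.trivial_on _ hG
    have hn0 : (Nat.card G : X.left.residueField x.pt) ≠ 0 := fun h0 => by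
      rw [h0, map_zero] at hn
      exact zero_ne_one hn
    obtain ⟨e, he⟩ := x.exists_reducesTo_of_abs_le
      (a := (Nat.card G : X.left.residueField x.pt)⁻¹) (by rw [map_inv₀, hn, inv_one])
    have hen : e * Nat.card G = 1 := by
      have h1 := he.mul (An.ReducesTo.natCast (Nat.card G))
      rw [inv_mul_cancel₀ hn0] at h1
      exact h1.unique (by simpa using An.ReducesTo.natCast (x := x) 1)
    have hmean := he.mul hsum
    rw [← mul_assoc, hen, one_mul] at hmean
    obtain ⟨a, ha, b, hb, hab⟩ := sum_actRes_mem_invariantFractions ρ x hx hUaff hU h c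
    refine ⟨_, ⟨a, ha, Nat.card G * b, mul_mem (natCast_mem _ _) hb, ?_⟩, hmean⟩
    rw [← hab, map_mul, map_natCast]
    field_simp
  · rintro ⟨_, ⟨a, ha, b, hb, rfl⟩, hd⟩ g
    have h' := hd.act ρ hx g
    rw [map_div₀, actRes_evaluation ρ x hx hU, actRes_evaluation ρ x hx hU,
      (mem_invariantFunctions ρ).1 ha, (mem_invariantFunctions ρ).1 hb] at h'
    exact h'.unique hd

/-- Both sides consist of the reductions of quotients of invariant functions. -/
theorem range_DResMap_quotMap [Finite G] (hG : (Nat.card G : k) ≠ 0) (x : An X)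
    (hx : x.IsInvariant ρ) {U : X.left.Opens} (hUaff : IsAffineOpen U) (hU : IsStable ρ U)
    (h : x.pt ∈ U) :
    ((x.restrict U h).DResMap (quotMap ρ U hU)).range =
      (x.invariantsDRes ρ hx).map (x.DResRestrict U h) := by
  ext e
  rw [An.mem_range_DResMap_iff, Subring.mem_map]
  constructor
  · rintro ⟨a, ha, he⟩
    obtain ⟨c, hc, rfl⟩ := (mem_range_residueFieldMap_quotMap_iff ρ x hU h a).1 ha
    have habs : x.abs c ≤ 1 := by
      rw [← x.abs_restrictRes U h c]
      exact he.abs_le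
    obtain ⟨d, hd⟩ := x.exists_reducesTo_of_abs_le habs
    exact ⟨d, (mem_invariantsDRes_iff ρ hG x hx hUaff hU h d).2 ⟨c, hc, hd⟩,
      (hd.restrict U h).unique he⟩
  · rintro ⟨d, hd, rfl⟩
    obtain ⟨c, hc, hd⟩ := (mem_invariantsDRes_iff ρ hG x hx hUaff hU h d).1 hd
    exact ⟨_, (mem_range_residueFieldMap_quotMap_iff ρ x hU h _).2 ⟨c, hc, rfl⟩,
      hd.restrict U h⟩

end Quotient

end Berkovich

end

theorem theorem5p5 {k : Type u} [Field k] (X : Over (Spec (.of k))) [IsIntegral X.left]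
    [IsSeparated X.hom] [LocallyOfFiniteType X.hom] [QuasiCompact X.hom]
    {G : Type*} [Group G] [Finite G] (hG : (Nat.card G : k) ≠ 0) (ρ : G →* Aut X)
    (x : Berkovich.An X) (hxstar : x.InStar) (hxG : x.IsInvariant ρ)
    (p : X.left) (hp : x.IsCenter p)
    (U : X.left.Opens) (hUaff : IsAffineOpen U) (hU : Berkovich.IsStable ρ U) (hpU : p ∈ U) :
    ((x.restrict U (hxstar.1.mem hpU)).DResMap (Berkovich.quotMap ρ U hU)).range =
      (x.invariantsDRes ρ hxG).map (x.DResRestrict U (hxstar.1.mem hpU)) := by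
  exact Berkovich.range_DResMap_quotMap ρ hG x hxG hUaff hU _
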